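/- Let $n\ge 1$ and $\mathbb R_+=(0,\infty)$; let $M_+(\mathbb R^n)$ and $M_+(\mathbb R_+)$ denote the classes of Lebesgue-measurable functions with values in $[0,\infty]$. An N-function is $\Phi(x)=\int_0^x\phi(y)\,dy$ with $\phi$ a nondecreasing map of $\mathbb R_+$ onto itself; its complementary function is $\Psi(t)=\int_0^t\phi^{-1}(s)\,ds$. For a measure space $X=\mathbb R_+$ or $X=\mathbb R^n$ (with Lebesgue measure) put $\rho_\Phi(f)=\inf\{\lambda>0:\int_X\Phi(f(x)/\lambda)\,dx\le 1\}$, and define $\rho_\Psi$ in the same way. For $f\in M_+(\mathbb R^n)$ let $f^*(t)=\inf\{\lambda\ge0:|\{x:f(x)>\lambda\}|\le t\}$, $t>0$, be its nonincreasing rearrangement. For $k,f\in M_+(\mathbb R^n)$ let $(T_kf)(x)=\int_{\mathbb R^n}k(x-y)f(y)\,dy$, and write $(Ik^*)(t)=\int_0^tk^*(s)\,ds$ and $(I_2k^*)(t)=\int_0^t(Ik^*)(s)\,ds=\int_0^t(t-s)k^*(s)\,ds$. **Theorem.** Fix $k\in M_+(\mathbb R^n)$ and let $\Phi_1,\Phi_2$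 be N-functions with complementary functions $\Psi_1,\Psi_2$, where $\Phi_2(2t)\approx\Phi_2(t)$ for all sufficiently large $t$. Put $\rho_i=\rho_{\Phi_i}$ and $\hat\rho_i=\rho_{\Psi_i}$, $i=1,2$. Suppose that there is a constant $C>0$ (possibly different in each of (i)–(iv)) such that (i) $\displaystyle \rho_1\Big(\frac1t\int_0^tf(s)\Big(\int_s^tk^*(y)\,dy\Big)ds\Big)\le C\rho_2(f)$ for all $f\in M_+(\mathbb R_+)$; (ii) $\displaystyle \hat\rho_2\Big(\frac1t\int_0^tg(s)\Big(\int_s^tk^*(y)\,dy\Big)ds\Big)\le C\hat\rho_1(g)$ for all $g\in M_+(\mathbb R_+)$; (iii) $\displaystyle \hat\rho_2\Big(\frac{(I_2k^*)(t)}t\int_t^\infty g(y)\,\frac{dy}y\Big)\le C\hat\rho_1(g)$ for all $g\in M_+(\mathbb R_+)$; (iv) $\displaystyle \hat\rho_2\Big(\frac1t\int_0^t\frac{(Ik^*)(s)}s\,g(s)\,ds\Big)\le C\hat\rho_1(g)$ for all $g\in M_+(\mathbb R_+)$. Then there is a constant $C>0$ such that, for all $f\in M_+(\mathbb R^n)$,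 $$\rho_1(T_kf)\le C\rho_2(f)\qquad\text{and}\qquad \rho_1\big((T_kf)^*\big)\le C\rho_2(f^*).$$ (In the first inequality the gauge norms are taken over $\mathbb R^n$, in the second over $\mathbb R_+$.) -/

import Mathlib

open MeasureTheory Set
open scoped ENNReal NNReal

noncomputable section

namespace OrliczGauge

/-- The data of an N-function `Φ(x) = ∫₀ˣ φ`: a nondecreasing function `φ` that maps
`(0, ∞)` onto itself.  The values of `φ` outside `(0, ∞)` are irrelevant. -/
structure NFunction where
  /-- the density `φ` -/
  density : ℝ → ℝ
  monotoneOn_density : MonotoneOn density (Ioi 0)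
  image_density : density '' Ioi 0 = Ioi 0

/-- `x ↦ ∫₀ˣ φ(y) dy` for `x ∈ [0, ∞]`. -/
def primitive (φ : ℝ → ℝ) (x : ℝ≥0∞) : ℝ≥0∞ :=
  ∫⁻ y in {y : ℝ | 0 < y ∧ ENNReal.ofReal y < x}, ENNReal.ofReal (φ y)

/-- The N-function `Φ(x) = ∫₀ˣ φ`, extended by `Φ(∞) = ∞`. -/
def NFunction.eval (N : NFunction) : ℝ≥0∞ → ℝ≥0∞ := primitive N.density

/-- The inverse `φ⁻¹` of the density on `(0, ∞)`.  Where `φ` is constant on an interval,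
the left end point is chosen; this happens for countably many values only, so the integral
of `φ⁻¹` does not depend on the choice. -/
def NFunction.densityInv (N : NFunction) (s : ℝ) : ℝ :=
  sInf {y : ℝ | 0 < y ∧ s ≤ N.density y}

/-- The complementary function `Ψ(t) = ∫₀ᵗ φ⁻¹`. -/
def NFunction.compl (N : NFunction) : ℝ≥0∞ → ℝ≥0∞ := primitive N.densityInv

/-- `Φ(2t) ≈ Φ(t)` for `t ≫ 1`. -/
def NFunction.DoublingAtInfinity (N : NFunction) : Prop :=
  ∃ C : ℝ≥0, ∃ t₀ : ℝ≥0, ∀ t : ℝ≥0, t₀ ≤ t →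
    N.eval (2 * t) ≤ C * N.eval t ∧ N.eval t ≤ C * N.eval (2 * t)

/-- The gauge norm `inf {l > 0 : ∫ Φ(f / l) dμ ≤ 1}` (it is `∞` if there is no such `l`). -/
def gaugeNorm {α : Type*} [MeasurableSpace α] (Φ : ℝ≥0∞ → ℝ≥0∞) (μ : Measure α)
    (f : α → ℝ≥0∞) : ℝ≥0∞ :=
  sInf {l : ℝ≥0∞ | 0 < l ∧ l < ∞ ∧ ∫⁻ x, Φ (f x / l) ∂μ ≤ 1}

/-- Lebesgue measure on `ℝ₊ = (0, ∞)`. -/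
def volPos : Measure ℝ := (volume : Measure ℝ).restrict (Ioi 0)

/-- The nonincreasing rearrangement of `f`, that is, the generalized inverse of its
distribution function: `f*(t) = inf {l ≥ 0 : |{x : f x > l}| ≤ t}`. -/
def rearr {n : ℕ} (f : EuclideanSpace ℝ (Fin n) → ℝ≥0∞) (t : ℝ) : ℝ≥0∞ :=
  sInf {l : ℝ≥0∞ | volume {x | l < f x} ≤ ENNReal.ofReal t}

/-- The convolution operator `(T_k f)(x) = ∫ k(x - y) f(y) dy`. -/
def convOp {n : ℕ} (k f : EuclideanSpace ℝ (Fin n) → ℝ≥0∞) (x : EuclideanSpace ℝ (Fin n)) :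
    ℝ≥0∞ :=
  ∫⁻ y, k (x - y) * f y

/-- `(I h)(t) = ∫₀ᵗ h`. -/
def opI (h : ℝ → ℝ≥0∞) (t : ℝ) : ℝ≥0∞ := ∫⁻ s in Ioo 0 t, h s

/-- `I₂ = I ∘ I`. -/
def opI₂ (h : ℝ → ℝ≥0∞) : ℝ → ℝ≥0∞ := opI (opI h)

/-- `t ↦ (1/t) ∫₀ᵗ f(s) (∫ₛᵗ κ) ds`. -/
def opA (κ f : ℝ → ℝ≥0∞) (t : ℝ) : ℝ≥0∞ :=
  (∫⁻ s in Ioo 0 t, f s * ∫⁻ y in Ioo s t, κ y) / ENNReal.ofReal t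

/-- `t ↦ ((I₂ κ)(t) / t) ∫ₜ^∞ g(y) dy / y`. -/
def opB (κ g : ℝ → ℝ≥0∞) (t : ℝ) : ℝ≥0∞ :=
  opI₂ κ t / ENNReal.ofReal t * ∫⁻ y in Ioi t, g y / ENNReal.ofReal y

/-- `t ↦ (1/t) ∫₀ᵗ ((I κ)(s) / s) g(s) ds`. -/
def opD (κ g : ℝ → ℝ≥0∞) (t : ℝ) : ℝ≥0∞ :=
  (∫⁻ s in Ioo 0 t, opI κ s / ENNReal.ofReal s * g s) / ENNReal.ofReal t

end OrliczGauge

end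

open OrliczGauge

noncomputable section

namespace OrliczGauge

/-! Everything rests on O'Neil's inequality: for t > 0, (T_k f)*(t) is at most (1/t)(Ik*)(t)(If*)(t)
+ ∫_t^∞ k* f* (`rearr_convOp_le`). To prove it, T_k f is integrated over a set E of measure at least
t inside {T_k f > a}, f is sliced into superlevel sets F, and the integral of k(x - y) over E × F is
bounded by min(|F| (Ik*)(|E|), |E| (Ik*)(|F|)).

Let A and B be the operators of hypotheses (i) and (iii), and A', B' their adjoints. Since k* and f*
are nonincreasing, the right side is at most A f* + 4 B' f* + 2 A'(f*(·/2)) (`opI_mul_opI_div_le`,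
`lintegral_Ioi_mul_le_opAdjA`). Hypothesis (i) bounds the first term. For the other two, (iii) and
(ii) bound B and A between the complementary spaces, and Orlicz duality transfers these bounds to B'
and A' (`gaugeNorm_adjoint_le`); dilation by two costs only a constant.

Duality needs both halves of Young's inequality: the inequality itself gives Hölder, and its
equality case at y = φ(x) recovers the Φ-modular of a function from its pairings
(`NFunction.lintegral_eval_le_one`). Finally, f and f* are equimeasurable, so they have the same
gauge norm and the two conclusions are equivalent. -/

/-! ### Primitives of densities and the layer-cake formula -/

/-- The interval `{y > 0 : y < x}` for an extended end point `x`. -/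
def below (x : ℝ≥0∞) : Set ℝ := {y : ℝ | 0 < y ∧ ENNReal.ofReal y < x}

/-- `∫₀ˣ w` for an extended-valued density `w` and `x ∈ [0, ∞]`. -/
def partialIntegral (w : ℝ → ℝ≥0∞) (x : ℝ≥0∞) : ℝ≥0∞ := ∫⁻ y in below x, w y

lemma measurableSet_below (x : ℝ≥0∞) : MeasurableSet (below x) :=
  measurableSet_Ioi.inter (measurableSet_lt ENNReal.measurable_ofReal measurable_const)

lemma below_mono {x y : ℝ≥0∞} (h : x ≤ y) : below x ⊆ below y := fun _ hz => ⟨hz.1, hz.2.trans_le h⟩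

lemma below_top : below ∞ = Ioi 0 := by ext; simp [below]

lemma below_ofReal (t : ℝ) : below (ENNReal.ofReal t) = Ioo 0 t := by
  ext y
  simp only [below, mem_ofPred_eq, mem_Ioo, and_congr_right_iff]
  exact fun hy => ENNReal.ofReal_lt_ofReal_iff_of_nonneg hy.le

lemma volume_below (x : ℝ≥0∞) : volume (below x) = x := by
  induction x with
  | top => simp [below_top]
  | coe r => rw [← ENNReal.ofReal_coe_nnreal, below_ofReal]; simp

lemma volume_below_inter_gt (x : ℝ≥0∞) {r : ℝ} (hr : 0 ≤ r) :
    volume (below x ∩ {v | ENNReal.ofReal r < ENNReal.ofReal v}) = x - ENNReal.ofReal r := by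
  have h : {v : ℝ | ENNReal.ofReal r < ENNReal.ofReal v} = Ioi r := by
    ext v; simp [ENNReal.ofReal_lt_ofReal_iff_of_nonneg hr]
  rw [h]
  induction x with
  | top => simp [below_top, Ioi_inter_Ioi]
  | coe q =>
    rw [← ENNReal.ofReal_coe_nnreal, below_ofReal, Ioo_inter_Ioi, max_eq_right hr, Real.volume_Ioo,
      ENNReal.ofReal_sub _ hr]

lemma partialIntegral_mono_right (w : ℝ → ℝ≥0∞) : Monotone (partialIntegral w) :=
  fun _ _ h => lintegral_mono_set (below_mono h)

lemma measurable_partialIntegral (w : ℝ → ℝ≥0∞) : Measurable (partialIntegral w) :=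
  (partialIntegral_mono_right w).measurable

lemma partialIntegral_zero (w : ℝ → ℝ≥0∞) : partialIntegral w 0 = 0 := by
  simp [partialIntegral, below]

lemma partialIntegral_const (c x : ℝ≥0∞) : partialIntegral (fun _ => c) x = c * x := by
  simp [partialIntegral, volume_below]

lemma partialIntegral_iSup (w : ℝ → ℝ≥0∞) {x : ℕ → ℝ≥0∞} (hx : Monotone x) :
    partialIntegral w (⨆ n, x n) = ⨆ n, partialIntegral w (x n) := by
  have h : below (⨆ n, x n) = ⋃ n, below (x n) := by
    ext y; simp [below, lt_iSup_iff]
  rw [partialIntegral, h, setLIntegral_iUnion_of_directed]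
  · rfl
  · exact directed_of_isDirected_le fun i j hij => below_mono (hx hij)

/-- Change of variables `y ↦ c * y` on a set. -/
lemma setLIntegral_mul_left {c : ℝ} (hc : 0 < c) (s : Set ℝ) (G : ℝ → ℝ≥0∞) :
    ∫⁻ y in s, G y = ENNReal.ofReal c * ∫⁻ y in (fun y => c * y) ⁻¹' s, G (c * y) := by
  have he : MeasurableEmbedding (fun y : ℝ => c * y) :=
    (Homeomorph.mulLeft₀ c hc.ne').measurableEmbedding
  have hv : (volume : Measure ℝ)
      = ENNReal.ofReal c • Measure.map (fun y : ℝ => c * y) volume := by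
    have := Real.smul_map_volume_mul_left hc.ne'
    rw [abs_of_pos hc] at this
    exact this.symm
  conv_lhs => rw [hv]
  rw [Measure.restrict_smul, lintegral_smul_measure, he.restrict_map, he.lintegral_map, smul_eq_mul]

/-- Convexity of W = ∫₀ w together with W(0) = 0. After substituting y = cv, it reduces to w(v) ≤
w(cv). This is how constants are absorbed into gauge norms below. -/
lemma mul_partialIntegral_div_le {w : ℝ → ℝ≥0∞} (hw : Monotone w) (x : ℝ≥0∞) {c : ℝ}
    (hc : 1 ≤ c) :
    ENNReal.ofReal c * partialIntegral w (x / ENNReal.ofReal c) ≤ partialIntegral w x := by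
  have hc0 : 0 < c := by linarith
  have hc1 : ENNReal.ofReal c ≠ 0 := by simpa using hc0
  rw [partialIntegral, partialIntegral, setLIntegral_mul_left hc0 (below x)]
  have h : (fun y => c * y) ⁻¹' below x = below (x / ENNReal.ofReal c) := by
    ext y
    simp only [below, mem_preimage, mem_ofPred_eq, mul_pos_iff_of_pos_left hc0,
      ENNReal.ofReal_mul hc0.le]
    rw [ENNReal.lt_div_iff_mul_lt (Or.inl hc1) (Or.inl ENNReal.ofReal_ne_top), mul_comm]
  rw [h]
  gcongr ENNReal.ofReal c * ?_
  refine setLIntegral_mono' (measurableSet_below _) fun y hy => hw ?_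
  exact le_mul_of_one_le_left hy.1.le hc

/-- Layer-cake formula. -/
lemma lintegral_partialIntegral {α : Type*} [MeasurableSpace α] (μ : Measure α) [SFinite μ]
    {w : ℝ → ℝ≥0∞} (hw : Measurable w) {f : α → ℝ≥0∞} (hf : Measurable f) :
    ∫⁻ x, partialIntegral w (f x) ∂μ
      = ∫⁻ y in Ioi (0 : ℝ), w y * μ {x | ENNReal.ofReal y < f x} := by
  have hS : MeasurableSet {p : α × ℝ | ENNReal.ofReal p.2 < f p.1} :=
    measurableSet_lt (ENNReal.measurable_ofReal.comp measurable_snd) (hf.comp measurable_fst)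
  have h1 : ∀ x, partialIntegral w (f x) = ∫⁻ y in Ioi (0 : ℝ),
      {p : α × ℝ | ENNReal.ofReal p.2 < f p.1}.indicator (fun p => w p.2) (x, y) := by
    intro x
    have : below (f x) = {y | ENNReal.ofReal y < f x} ∩ Ioi 0 := by
      ext y; simp [below, and_comm]
    rw [partialIntegral, this, ← Measure.restrict_restrict
      (measurableSet_lt ENNReal.measurable_ofReal measurable_const), ← lintegral_indicator
      (measurableSet_lt ENNReal.measurable_ofReal measurable_const)]
    rfl
  simp_rw [h1]
  rw [lintegral_lintegral_swap (f := fun x y =>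
      {p : α × ℝ | ENNReal.ofReal p.2 < f p.1}.indicator (fun p => w p.2) (x, y))
    (((hw.comp measurable_snd).indicator hS).aemeasurable)]
  refine lintegral_congr fun y => ?_
  have h2 : ∀ x, {p : α × ℝ | ENNReal.ofReal p.2 < f p.1}.indicator (fun p => w p.2) (x, y)
      = {x | ENNReal.ofReal y < f x}.indicator (fun _ => w y) x := fun x => rfl
  simp_rw [h2]
  rw [lintegral_indicator (measurableSet_lt measurable_const hf), setLIntegral_const]

lemma lintegral_eq_lintegral_meas_lt {α : Type*} [MeasurableSpace α] (μ : Measure α) [SFinite μ]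
    {f : α → ℝ≥0∞} (hf : Measurable f) :
    ∫⁻ x, f x ∂μ = ∫⁻ y in Ioi (0 : ℝ), μ {x | ENNReal.ofReal y < f x} := by
  simpa [partialIntegral_const] using lintegral_partialIntegral μ (w := fun _ => 1)
    measurable_const hf

/-! ### Nonincreasing rearrangement and equimeasurability -/

section Rearrangement

variable {n : ℕ}

/-- The infimum defining f*(t) is attained: {f > f*(t)} is the increasing union of the sets {f > u}
for levels u decreasing to f*(t). -/
lemma volume_rearr_lt_le (f : EuclideanSpace ℝ (Fin n) → ℝ≥0∞) (t : ℝ) :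
    volume {x | rearr f t < f x} ≤ ENNReal.ofReal t := by
  by_cases htop : rearr f t = ∞
  · simp [htop]
  have hne : (Ioi (rearr f t)).Nonempty := ⟨∞, lt_top_iff_ne_top.2 htop⟩
  obtain ⟨u, hu, hlt, hlim⟩ := exists_seq_strictAnti_tendsto' (lt_top_iff_ne_top.2 htop)
  have h : {x | rearr f t < f x} = ⋃ m, {x | u m < f x} := by
    ext x
    simp only [mem_ofPred_eq, mem_iUnion]
    constructor
    · intro hx
      exact (hlim.eventually (gt_mem_nhds hx)).exists
    · rintro ⟨m, hm⟩
      exact (hlt m).1.trans hm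
  rw [h, Monotone.measure_iUnion]
  · refine iSup_le fun m => ?_
    obtain ⟨l, hl, hlu⟩ := sInf_lt_iff.1 (hlt m).1
    exact (measure_mono fun x hx => hlu.trans hx).trans hl
  · intro i j hij x hx
    exact (hu.antitone hij).trans_lt hx

lemma lt_rearr_iff (f : EuclideanSpace ℝ (Fin n) → ℝ≥0∞) (t : ℝ) (l : ℝ≥0∞) :
    l < rearr f t ↔ ENNReal.ofReal t < volume {x | l < f x} := by
  rw [← not_le, ← not_le, not_iff_not]
  constructor
  · intro h
    exact (measure_mono fun x hx => h.trans_lt hx).trans (volume_rearr_lt_le f t)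
  · exact fun h => sInf_le h

lemma rearr_antitone (f : EuclideanSpace ℝ (Fin n) → ℝ≥0∞) : Antitone (rearr f) := by
  intro s t hst
  exact sInf_le_sInf fun l hl => le_trans hl (ENNReal.ofReal_le_ofReal hst)

lemma rearr_congr {f g : EuclideanSpace ℝ (Fin n) → ℝ≥0∞} (h : f =ᵐ[volume] g) :
    rearr f = rearr g := by
  ext t
  unfold rearr
  congr 1
  ext l
  have : volume {x | l < f x} = volume {x | l < g x} := by
    apply measure_congr
    filter_upwards [h] with x hx
    show (l < f x) = (l < g x)
    rw [hx]
  simp [this]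

lemma lintegral_partialIntegral_rearr {w : ℝ → ℝ≥0∞} (hw : Measurable w)
    {f : EuclideanSpace ℝ (Fin n) → ℝ≥0∞} (hf : Measurable f) {l : ℝ≥0∞} (hl : l ≠ 0)
    (hl' : l ≠ ∞) :
    ∫⁻ t, partialIntegral w (rearr f t / l) ∂volPos = ∫⁻ x, partialIntegral w (f x / l) := by
  have : SFinite volPos := by unfold volPos; infer_instance
  rw [lintegral_partialIntegral _ hw (hf.div_const l), lintegral_partialIntegral _ hw
    ((rearr_antitone f).measurable.div_const l)]
  refine setLIntegral_congr_fun measurableSet_Ioi fun y _ => ?_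
  simp only [ENNReal.lt_div_iff_mul_lt (Or.inl hl) (Or.inl hl'), lt_rearr_iff]
  congr 1
  rw [volPos, Measure.restrict_apply]
  · have : {t | ENNReal.ofReal t < volume {x | ENNReal.ofReal y * l < f x}} ∩ Ioi 0
      = below (volume {x | ENNReal.ofReal y * l < f x}) := by
      ext t; simp [below, and_comm]
    rw [this, volume_below]
  · exact measurableSet_lt ENNReal.measurable_ofReal measurable_const

lemma gaugeNorm_rearr {w : ℝ → ℝ≥0∞} (hw : Measurable w)
    {f : EuclideanSpace ℝ (Fin n) → ℝ≥0∞} (hf : Measurable f) :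
    gaugeNorm (partialIntegral w) volPos (rearr f) = gaugeNorm (partialIntegral w) volume f := by
  unfold gaugeNorm
  congr 1
  ext l
  simp only [mem_ofPred_eq]
  refine and_congr_right fun h0 => and_congr_right fun ht => ?_
  rw [lintegral_partialIntegral_rearr hw hf h0.ne' ht.ne]

/-- Hardy–Littlewood: `∫_F h ≤ ∫₀^{|F|} k*` if `h` and `k` are equimeasurable. -/
lemma setLIntegral_le_partialIntegral_rearr {k h : EuclideanSpace ℝ (Fin n) → ℝ≥0∞}
    (hh : Measurable h)
    (heq : ∀ l, volume {x | l < h x} = volume {x | l < k x})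
    (F : Set (EuclideanSpace ℝ (Fin n))) :
    ∫⁻ y in F, h y ≤ partialIntegral (rearr k) (volume F) := by
  rw [partialIntegral, lintegral_eq_lintegral_meas_lt _ hh,
    lintegral_eq_lintegral_meas_lt _ (rearr_antitone k).measurable]
  refine lintegral_mono fun l => ?_
  rw [Measure.restrict_apply (measurableSet_lt measurable_const hh),
    Measure.restrict_apply (measurableSet_lt measurable_const (rearr_antitone k).measurable)]
  -- At height l the right side contributes exactly min(|F|, |{k > l}|), which dominates |F ∩ {h >
  -- l}|.
  have : {a | ENNReal.ofReal l < rearr k a} ∩ below (volume F)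
      = below (min (volume F) (volume {x | ENNReal.ofReal l < k x})) := by
    ext s
    simp only [below, mem_inter_iff, mem_ofPred_eq, lt_rearr_iff, lt_min_iff]
    tauto
  rw [this, volume_below, ← heq]
  exact le_min (measure_mono inter_subset_right) (measure_mono inter_subset_left)

/-- `∫₀^∞ W(|{f > l}|) dl = ∫₀^∞ w f*` for `W = ∫₀ w`. -/
lemma lintegral_partialIntegral_volume_lt {w : ℝ → ℝ≥0∞} (hw : Measurable w)
    (f : EuclideanSpace ℝ (Fin n) → ℝ≥0∞) :
    ∫⁻ l in Ioi (0 : ℝ), partialIntegral w (volume {x | ENNReal.ofReal l < f x})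
      = ∫⁻ s in Ioi (0 : ℝ), w s * rearr f s := by
  have hm : Antitone fun l : ℝ => volume {x | ENNReal.ofReal l < f x} := fun a b hab =>
    measure_mono fun x hx => (ENNReal.ofReal_le_ofReal hab).trans_lt hx
  rw [lintegral_partialIntegral _ hw hm.measurable]
  refine lintegral_congr fun s => ?_
  congr 1
  rw [Measure.restrict_apply (measurableSet_lt measurable_const hm.measurable)]
  have : {l : ℝ | ENNReal.ofReal s < volume {x | ENNReal.ofReal l < f x}} ∩ Ioi 0
      = below (rearr f s) := by
    ext l; simp [below, lt_rearr_iff, and_comm]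
  rw [this, volume_below]

end Rearrangement

/-! ### Young's inequality and Orlicz duality -/

namespace NFunction

/-- The density `φ`, extended by zero to `(-∞, 0]`. -/
def weight (N : NFunction) : ℝ → ℝ≥0∞ := (Ioi 0).indicator fun y => ENNReal.ofReal (N.density y)

/-- The inverse density `φ⁻¹`, extended by zero to `(-∞, 0]`. -/
def weightInv (N : NFunction) : ℝ → ℝ≥0∞ :=
  (Ioi 0).indicator fun y => ENNReal.ofReal (N.densityInv y)

variable (N : NFunction)

lemma density_pos {u : ℝ} (hu : 0 < u) : 0 < N.density u := by
  have : N.density u ∈ N.density '' Ioi 0 := ⟨u, hu, rfl⟩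
  rw [N.image_density] at this
  exact this

lemma weight_of_pos {u : ℝ} (hu : 0 < u) : N.weight u = ENNReal.ofReal (N.density u) :=
  indicator_of_mem (mem_Ioi.2 hu) _

lemma weightInv_of_pos {u : ℝ} (hu : 0 < u) : N.weightInv u = ENNReal.ofReal (N.densityInv u) :=
  indicator_of_mem (mem_Ioi.2 hu) _

lemma weight_ne_top (u : ℝ) : N.weight u ≠ ∞ := by
  unfold weight
  by_cases h : u ∈ Ioi (0 : ℝ) <;> simp [h]

lemma monotone_indicator_ofReal {φ : ℝ → ℝ} (h : MonotoneOn φ (Ioi 0)) :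
    Monotone ((Ioi 0).indicator fun y => ENNReal.ofReal (φ y)) := by
  intro a b hab
  by_cases ha : 0 < a
  · have hb : 0 < b := ha.trans_le hab
    rw [indicator_of_mem (mem_Ioi.2 ha), indicator_of_mem (mem_Ioi.2 hb)]
    exact ENNReal.ofReal_le_ofReal (h ha hb hab)
  · rw [indicator_of_notMem (by simpa using ha)]
    exact zero_le

lemma monotone_weight : Monotone N.weight := monotone_indicator_ofReal N.monotoneOn_density

lemma bddBelow_densityInv_set (s : ℝ) : BddBelow {y : ℝ | 0 < y ∧ s ≤ N.density y} :=
  ⟨0, fun _ hy => hy.1.le⟩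

/-- Surjectivity of φ enters here; the real infimum of an empty set would be 0 by convention and
spoil the generalized inverse. -/
lemma densityInv_set_nonempty {s : ℝ} (hs : 0 < s) : {y : ℝ | 0 < y ∧ s ≤ N.density y}.Nonempty := by
  have : s ∈ N.density '' Ioi 0 := by rw [N.image_density]; exact hs
  obtain ⟨y, hy, rfl⟩ := this
  exact ⟨y, hy, le_rfl⟩

lemma monotone_weightInv : Monotone N.weightInv :=
  monotone_indicator_ofReal fun _ _ _ hb hab =>
    csInf_le_csInf (N.bddBelow_densityInv_set _) (N.densityInv_set_nonempty hb)
      fun _ hy => ⟨hy.1, hab.trans hy.2⟩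

lemma le_densityInv {u v : ℝ} (hu : 0 < u) (hv : 0 < v) (h : N.density u < v) :
    u ≤ N.densityInv v := by
  refine le_csInf (N.densityInv_set_nonempty hv) fun w hw => ?_
  by_contra! hlt
  exact absurd (N.monotoneOn_density hw.1 hu hlt.le) (not_le.2 (h.trans_le hw.2))

lemma densityInv_le {u v : ℝ} (hu : 0 < u) (h : v ≤ N.density u) : N.densityInv v ≤ u :=
  csInf_le (N.bddBelow_densityInv_set _) ⟨hu, h⟩

lemma eval_eq : N.eval = partialIntegral N.weight := by
  ext x
  exact setLIntegral_congr_fun (measurableSet_below x) fun y hy => (N.weight_of_pos hy.1).symm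

lemma compl_eq : N.compl = partialIntegral N.weightInv := by
  ext x
  exact setLIntegral_congr_fun (measurableSet_below x) fun y hy => (N.weightInv_of_pos hy.1).symm

/-- The area of `{(u, v) : u < x, φ(u) < v < y}`, computed in both orders. -/
lemma lintegral_sub_weight (x y : ℝ≥0∞) :
    ∫⁻ u in below x, (y - N.weight u)
      = ∫⁻ v in below y, volume (below x ∩ {u | N.weight u < ENNReal.ofReal v}) := by
  have hS : MeasurableSet {p : ℝ × ℝ | N.weight p.1 < ENNReal.ofReal p.2} :=
    measurableSet_lt (N.monotone_weight.measurable.comp measurable_fst)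
      (ENNReal.measurable_ofReal.comp measurable_snd)
  have h := (Measure.prod_apply (μ := volume.restrict (below x))
    (ν := volume.restrict (below y)) hS).symm.trans (Measure.prod_apply_symm hS)
  convert h using 2
  · ext u
    rw [Measure.restrict_apply (measurable_prodMk_left hS), inter_comm,
      ← ENNReal.ofReal_toReal (N.weight_ne_top u), ← volume_below_inter_gt y ENNReal.toReal_nonneg,
      ENNReal.ofReal_toReal (N.weight_ne_top u)]
    rfl
  · ext v
    rw [Measure.restrict_apply (measurable_prodMk_right hS), inter_comm]
    rfl

/-- Young's inequality. -/
lemma mul_le_eval_add_compl (x y : ℝ≥0∞) : x * y ≤ N.eval x + N.compl y := by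
  rw [eval_eq, compl_eq]
  calc x * y = ∫⁻ _ in below x, y := by simp [volume_below, mul_comm]
    -- The rectangle of sides x and y is covered by the region under the graph of φ and the region
    -- above it. The truncated difference is the height of the latter, whose horizontal slices have
    -- length at most φ⁻¹(v).
    _ ≤ ∫⁻ u in below x, (N.weight u + (y - N.weight u)) :=
        lintegral_mono fun u => le_add_tsub
    _ = partialIntegral N.weight x
        + ∫⁻ v in below y, volume (below x ∩ {u | N.weight u < ENNReal.ofReal v}) := by
        rw [lintegral_add_left N.monotone_weight.measurable, lintegral_sub_weight]; rfl
    _ ≤ _ := by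
        refine add_le_add_right (setLIntegral_mono' (measurableSet_below y) fun v hv => ?_) _
        rw [N.weightInv_of_pos hv.1]
        calc _ ≤ volume (Icc 0 (N.densityInv v)) := by
              refine measure_mono fun u hu => ⟨hu.1.1.le, N.le_densityInv hu.1.1 hv.1 ?_⟩
              have h := hu.2
              rw [mem_ofPred_eq, N.weight_of_pos hu.1.1] at h
              exact (ENNReal.ofReal_lt_ofReal_iff hv.1).1 h
          _ = _ := by simp

/-- The equality case of Young's inequality. -/
lemma eval_add_compl_weight_le {x : ℝ≥0∞} (hx : x ≠ ∞) :
    N.eval x + N.compl (N.weight x.toReal) ≤ x * N.weight x.toReal := by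
  rw [eval_eq, compl_eq]
  lift x to ℝ≥0 using hx
  rcases eq_or_ne x 0 with rfl | hx0
  · simp [weight, partialIntegral_zero]
  have hx : 0 < (x : ℝ) := by positivity
  rw [ENNReal.coe_toReal]
  calc partialIntegral N.weight x + partialIntegral N.weightInv (N.weight x)
      ≤ partialIntegral N.weight x + ∫⁻ v in below (N.weight x),
          volume (below x ∩ {u | N.weight u < ENNReal.ofReal v}) := by
        refine add_le_add_right (setLIntegral_mono' (measurableSet_below _) fun v hv => ?_) _
        have hvx : v < N.density x := by
          have := hv.2
          rw [N.weight_of_pos hx] at this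
          exact (ENNReal.ofReal_lt_ofReal_iff (N.density_pos hx)).1 this
        rw [N.weightInv_of_pos hv.1]
        calc _ = volume (Ioo 0 (N.densityInv v)) := by simp
          _ ≤ _ := by
            -- The slice inclusion of Young's inequality is reversed here: for v < φ(x), every u in
            -- (0, φ⁻¹(v)) satisfies u < x and φ(u) < v.
            refine measure_mono fun u hu => ⟨⟨hu.1, ?_⟩, ?_⟩
            · rw [← ENNReal.ofReal_coe_nnreal, ENNReal.ofReal_lt_ofReal_iff hx]
              exact hu.2.trans_le (N.densityInv_le hx hvx.le)
            · rw [mem_ofPred_eq, N.weight_of_pos hu.1, ENNReal.ofReal_lt_ofReal_iff hv.1]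
              by_contra! hle
              exact absurd (N.densityInv_le hu.1 hle) (not_le.2 hu.2)
    _ = ∫⁻ u in below x, (N.weight u + (N.weight x - N.weight u)) := by
        rw [lintegral_add_left N.monotone_weight.measurable, lintegral_sub_weight]; rfl
    _ = ∫⁻ _ in below x, N.weight x := by
        refine setLIntegral_congr_fun (measurableSet_below _) fun u hu => ?_
        refine add_tsub_cancel_of_le (N.monotone_weight ?_)
        have := hu.2
        rw [← ENNReal.ofReal_coe_nnreal, ENNReal.ofReal_lt_ofReal_iff hx] at this
        exact this.le
    _ = _ := by simp [volume_below, mul_comm]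

lemma measurable_eval : Measurable N.eval := by
  rw [eval_eq]; exact measurable_partialIntegral _

lemma measurable_compl : Measurable N.compl := by
  rw [compl_eq]; exact measurable_partialIntegral _

/-- Hölder's inequality for a pair of functions of modular at most one. -/
lemma lintegral_mul_le_two {α : Type*} [MeasurableSpace α] {μ : Measure α}
    {f g : α → ℝ≥0∞} (hf : Measurable f) (hf1 : ∫⁻ x, N.eval (f x) ∂μ ≤ 1)
    (hg1 : ∫⁻ x, N.compl (g x) ∂μ ≤ 1) : ∫⁻ x, f x * g x ∂μ ≤ 2 :=
  calc ∫⁻ x, f x * g x ∂μ ≤ ∫⁻ x, (N.eval (f x) + N.compl (g x)) ∂μ :=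
        lintegral_mono fun _ => N.mul_le_eval_add_compl _ _
    _ = _ := lintegral_add_left (N.measurable_eval.comp hf) _
    _ ≤ 1 + 1 := add_le_add hf1 hg1
    _ = 2 := one_add_one_eq_two

/-- Test with g = φ(h) and let a = ∫ Ψ(g), so that the equality case of Young gives ∫ Φ(h) + a ≤ ∫ h
g. If a ≤ 1, the hypothesis applies to g. If a > 1, convexity makes g / a admissible, so ∫ h g ≤ a,
and cancelling a leaves ∫ Φ(h) ≤ 0. Boundedness and the support of finite measure are there to make
a finite. -/
lemma lintegral_eval_le_one_of_bounded {α : Type*} [MeasurableSpace α] {μ : Measure α}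
    {h : α → ℝ≥0∞} (hh : Measurable h) {M : ℝ≥0} (hM : ∀ x, h x ≤ M) {S : Set α}
    (hS : MeasurableSet S) (hSμ : μ S ≠ ∞) (hsupp : ∀ x ∉ S, h x = 0)
    (H : ∀ g : α → ℝ≥0∞, Measurable g → ∫⁻ x, N.compl (g x) ∂μ ≤ 1 → ∫⁻ x, h x * g x ∂μ ≤ 1) :
    ∫⁻ x, N.eval (h x) ∂μ ≤ 1 := by
  set g : α → ℝ≥0∞ := fun x => N.weight (h x).toReal with hgdef
  have hg : Measurable g := N.monotone_weight.measurable.comp hh.ennreal_toReal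
  have hfin : ∀ x, h x ≠ ∞ := fun x => ne_top_of_le_ne_top ENNReal.coe_ne_top (hM x)
  set a := ∫⁻ x, N.compl (g x) ∂μ with ha
  have hsum : ∫⁻ x, N.eval (h x) ∂μ + a ≤ ∫⁻ x, h x * g x ∂μ := by
    rw [ha, ← lintegral_add_left (f := fun x => N.eval (h x)) (N.measurable_eval.comp hh)]
    exact lintegral_mono fun x => N.eval_add_compl_weight_le (hfin x)
  have hafin : a ≠ ∞ := by
    have hb : N.compl (N.weight M) ≠ ∞ := by
      have := N.eval_add_compl_weight_le (x := M) ENNReal.coe_ne_top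
      refine ne_top_of_le_ne_top ?_ (le_add_self.trans this)
      exact ENNReal.mul_ne_top ENNReal.coe_ne_top (N.weight_ne_top _)
    refine ne_top_of_le_ne_top (ENNReal.mul_ne_top hb hSμ) ?_
    calc a ≤ ∫⁻ x, S.indicator (fun _ => N.compl (N.weight M)) x ∂μ := by
          refine lintegral_mono fun x => ?_
          by_cases hx : x ∈ S
          · rw [indicator_of_mem hx, compl_eq]
            refine partialIntegral_mono_right _ (N.monotone_weight ?_)
            exact ENNReal.toReal_mono ENNReal.coe_ne_top (hM x)
          -- Off S the extension of φ by zero matters: it gives g = 0 where h = 0.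
          · simp [hgdef, hsupp x hx, weight, compl_eq, partialIntegral_zero]
      _ = _ := by rw [lintegral_indicator hS, setLIntegral_const]
  rcases le_or_gt a 1 with h1 | h1
  · exact (le_self_add.trans hsum).trans (H g hg h1)
  · have hc : 1 ≤ a.toReal := by
      have := ENNReal.toReal_mono hafin h1.le
      simpa using this
    have ha0 : a ≠ 0 := (zero_lt_one.trans h1).ne'
    have hdiv : ∫⁻ x, N.compl (g x / a) ∂μ ≤ 1 := by
      have hle : a * ∫⁻ x, N.compl (g x / a) ∂μ ≤ a * 1 := by
        rw [← lintegral_const_mul (f := fun x => N.compl (g x / a)) _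
          (N.measurable_compl.comp (hg.div_const a)), mul_one]
        conv_rhs => rw [ha]
        refine lintegral_mono fun x => ?_
        have := mul_partialIntegral_div_le N.monotone_weightInv (g x) hc
        rw [ENNReal.ofReal_toReal hafin] at this
        rwa [compl_eq]
      exact (ENNReal.mul_le_mul_iff_right ha0 hafin).1 hle
    have h2 := H (fun x => g x / a) (hg.div_const a) hdiv
    have h3 : ∫⁻ x, h x * g x ∂μ ≤ a := by
      have : ∫⁻ x, h x * (g x / a) ∂μ = (∫⁻ x, h x * g x ∂μ) / a := by
        simp only [div_eq_mul_inv, ← mul_assoc]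
        exact lintegral_mul_const _ (hh.mul hg)
      rw [this, ENNReal.div_le_iff ha0 hafin, one_mul] at h2
      exact h2
    have h4 : ∫⁻ x, N.eval (h x) ∂μ + a ≤ 0 + a := by
      rw [zero_add]; exact hsum.trans h3
    exact ((ENNReal.add_le_add_iff_right hafin).1 h4).trans zero_le

/-- A function whose pairing with every function of `Ψ`-modular at most one is at most one has
`Φ`-modular at most one. -/
lemma lintegral_eval_le_one {α : Type*} [MeasurableSpace α] {μ : Measure α} [SigmaFinite μ]
    {h : α → ℝ≥0∞} (hh : Measurable h)
    (H : ∀ g : α → ℝ≥0∞, Measurable g → ∫⁻ x, N.compl (g x) ∂μ ≤ 1 → ∫⁻ x, h x * g x ∂μ ≤ 1) :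
    ∫⁻ x, N.eval (h x) ∂μ ≤ 1 := by
  -- Truncation in height and in space reduces to the bounded case; Φ commutes with increasing
  -- limits, so monotone convergence returns to h.
  set F : ℕ → α → ℝ≥0∞ := fun n => (spanningSets μ n).indicator fun x => min (h x) n with hF
  have hFm : ∀ n, Measurable (F n) := fun n =>
    (hh.min measurable_const).indicator (measurableSet_spanningSets μ n)
  have hmono : Monotone F := by
    intro m n hmn x
    simp only [hF]
    by_cases hx : x ∈ spanningSets μ m
    · rw [indicator_of_mem hx, indicator_of_mem (monotone_spanningSets μ hmn hx)]
      exact min_le_min_left _ (by exact_mod_cast hmn)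
    · rw [indicator_of_notMem hx]; exact zero_le
  have hle : ∀ n x, F n x ≤ h x := by
    intro n x
    simp only [hF]
    exact (indicator_le_self _ _ x).trans (min_le_left _ _)
  have hsup : ∀ x, ⨆ n, F n x = h x := by
    intro x
    refine le_antisymm (iSup_le fun n => hle n x) (le_of_forall_lt fun c hc => ?_)
    obtain ⟨i, hi⟩ : ∃ i, x ∈ spanningSets μ i := by
      have : x ∈ ⋃ i, spanningSets μ i := by rw [iUnion_spanningSets]; trivial
      exact mem_iUnion.1 this
    obtain ⟨m, hm⟩ := ENNReal.exists_nat_gt hc.ne_top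
    refine lt_iSup_iff.2 ⟨max i m, ?_⟩
    simp only [hF]
    rw [indicator_of_mem (monotone_spanningSets μ (le_max_left i m) hi)]
    exact lt_min hc (hm.trans_le (by exact_mod_cast le_max_right i m))
  have hev : ∀ x, N.eval (h x) = ⨆ n, N.eval (F n x) := by
    intro x
    rw [eval_eq, ← partialIntegral_iSup _ fun m n hmn => hmono hmn x, hsup]
  simp_rw [hev]
  rw [lintegral_iSup (f := fun n x => N.eval (F n x)) (fun n => N.measurable_eval.comp (hFm n))]
  · refine iSup_le fun n => ?_
    refine N.lintegral_eval_le_one_of_bounded (hFm n) (M := n) (fun x => ?_)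
      (measurableSet_spanningSets μ n) (measure_spanningSets_lt_top μ n).ne
      (fun x hx => indicator_of_notMem hx _) fun g hg hg1 => ?_
    · exact (indicator_le_self _ _ x).trans (min_le_right _ _)
    · exact (lintegral_mono fun x => mul_le_mul_left (hle n x) _).trans (H g hg hg1)
  · intro m n hmn x
    simp only [eval_eq]
    exact partialIntegral_mono_right _ (hmono hmn x)

end NFunction

/-! ### Averages of nonincreasing functions and O'Neil's inequality -/

lemma opI_eq (κ : ℝ → ℝ≥0∞) (t : ℝ) : opI κ t = partialIntegral κ (ENNReal.ofReal t) := by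
  rw [opI, partialIntegral, below_ofReal]

lemma monotone_opI (κ : ℝ → ℝ≥0∞) : Monotone (opI κ) := fun _ _ h =>
  lintegral_mono_set (Ioo_subset_Ioo_right h)

lemma measurable_opI (κ : ℝ → ℝ≥0∞) : Measurable (opI κ) := (monotone_opI κ).measurable

lemma measurable_opI₂ (κ : ℝ → ℝ≥0∞) : Measurable (opI₂ κ) := measurable_opI _

lemma partialIntegral_eq_add (κ : ℝ → ℝ≥0∞) {x y : ℝ≥0∞} (h : x ≤ y) :
    partialIntegral κ y = partialIntegral κ x + ∫⁻ s in below y \ below x, κ s := by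
  rw [partialIntegral, partialIntegral,
    ← lintegral_inter_add_sdiff κ (below y) (measurableSet_below x),
    inter_eq_self_of_subset_right (below_mono h)]

lemma le_of_mem_below_diff {t s : ℝ} {x : ℝ≥0∞}
    (hs : s ∈ below x \ below (ENNReal.ofReal t)) : t ≤ s := by
  by_contra! h
  refine hs.2 ?_
  rw [below_ofReal]
  exact ⟨hs.1.1, h⟩

/-- The average of a nonincreasing function is nonincreasing. -/
lemma ofReal_mul_partialIntegral_le {κ : ℝ → ℝ≥0∞} (hκ : Antitone κ) {t : ℝ}
    {m : ℝ≥0∞} (hm : ENNReal.ofReal t ≤ m) :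
    ENNReal.ofReal t * partialIntegral κ m ≤ m * partialIntegral κ (ENNReal.ofReal t) := by
  have h1 : ∫⁻ s in below m \ below (ENNReal.ofReal t), κ s ≤ κ t * (m - ENNReal.ofReal t) := by
    calc _ ≤ ∫⁻ _ in below m \ below (ENNReal.ofReal t), κ t :=
          setLIntegral_mono' ((measurableSet_below _).diff (measurableSet_below _))
            fun s hs => hκ (le_of_mem_below_diff hs)
      _ = _ := by
          rw [setLIntegral_const, measure_sdiff (below_mono hm)
            (measurableSet_below _).nullMeasurableSet (by simp [volume_below]), volume_below,
            volume_below]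
  have h2 : ENNReal.ofReal t * κ t ≤ partialIntegral κ (ENNReal.ofReal t) := by
    calc _ = ∫⁻ _ in below (ENNReal.ofReal t), κ t := by
          rw [setLIntegral_const, volume_below, mul_comm]
      _ ≤ _ := by
          refine setLIntegral_mono' (measurableSet_below _) fun s hs => hκ ?_
          rw [below_ofReal] at hs
          exact hs.2.le
  calc ENNReal.ofReal t * partialIntegral κ m
      ≤ ENNReal.ofReal t * (partialIntegral κ (ENNReal.ofReal t)
          + κ t * (m - ENNReal.ofReal t)) := by
        rw [partialIntegral_eq_add κ hm]; gcongr
    _ = ENNReal.ofReal t * partialIntegral κ (ENNReal.ofReal t)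
          + (m - ENNReal.ofReal t) * (ENNReal.ofReal t * κ t) := by ring
    _ ≤ ENNReal.ofReal t * partialIntegral κ (ENNReal.ofReal t)
          + (m - ENNReal.ofReal t) * partialIntegral κ (ENNReal.ofReal t) := by gcongr
    _ = _ := by rw [← add_mul, add_tsub_cancel_of_le hm]

/-- The derivative of `u ↦ min (u (Iκ)(t), t (Iκ)(u))`. -/
def oneilWeight (κ : ℝ → ℝ≥0∞) (t s : ℝ) : ℝ≥0∞ :=
  if s < t then opI κ t else ENNReal.ofReal t * κ s

lemma measurable_oneilWeight {κ : ℝ → ℝ≥0∞} (hκ : Measurable κ) (t : ℝ) :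
    Measurable (oneilWeight κ t) :=
  Measurable.ite measurableSet_Iio measurable_const (hκ.const_mul _)

/-- Written as a primitive in u, the bound can be evaluated at u = |{f > l}| and integrated in l,
which yields the integral of the weight against f*. Only this inequality is needed, so κ need not be
monotone: the primitive equals the first entry for u ≤ t and the second for u ≥ t. -/
lemma min_le_partialIntegral_oneilWeight {κ : ℝ → ℝ≥0∞} (hκ : Measurable κ) (t : ℝ) (u : ℝ≥0∞) :
    min (u * opI κ t) (ENNReal.ofReal t * partialIntegral κ u)
      ≤ partialIntegral (oneilWeight κ t) u := by
  have hlt : ∀ x ≤ ENNReal.ofReal t, partialIntegral (oneilWeight κ t) x = x * opI κ t := by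
    intro x hx
    rw [mul_comm, ← partialIntegral_const]
    refine setLIntegral_congr_fun (measurableSet_below x) fun s hs => if_pos ?_
    have := below_mono hx hs
    rw [below_ofReal] at this
    exact this.2
  rcases le_total u (ENNReal.ofReal t) with hu | hu
  · rw [hlt u hu]; exact min_le_left _ _
  · refine (min_le_right _ _).trans (le_of_eq ?_)
    rw [partialIntegral_eq_add _ hu, partialIntegral_eq_add _ hu, hlt _ le_rfl, mul_add, opI_eq,
      ← lintegral_const_mul _ hκ]
    congr 1
    refine setLIntegral_congr_fun ((measurableSet_below _).diff (measurableSet_below _))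
      fun s hs => (if_neg (not_lt.2 (le_of_mem_below_diff hs))).symm

lemma lintegral_oneilWeight_mul {κ f : ℝ → ℝ≥0∞} (hκ : Measurable κ) (hf : Measurable f) {t : ℝ}
    (ht : 0 < t) :
    ∫⁻ s in Ioi 0, oneilWeight κ t s * f s
      = opI κ t * opI f t + ENNReal.ofReal t * ∫⁻ s in Ioi t, κ s * f s := by
  rw [← lintegral_inter_add_sdiff _ (Ioi (0 : ℝ)) (measurableSet_Iio (a := t))]
  have h1 : Ioi 0 ∩ Iio t = Ioo 0 t := rfl
  have h2 : Ioi 0 \ Iio t = Ici t := by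
    ext s; simp only [mem_sdiff, mem_Ioi, mem_Iio, not_lt, mem_Ici]
    exact ⟨fun h => h.2, fun h => ⟨ht.trans_le h, h⟩⟩
  rw [h1, h2]
  congr 1
  · conv_rhs => rw [opI.eq_1 f]
    rw [← lintegral_const_mul _ hf]
    refine setLIntegral_congr_fun measurableSet_Ioo fun s hs => ?_
    simp only [oneilWeight, if_pos hs.2]
  · rw [← lintegral_const_mul (f := fun s => κ s * f s) _ (hκ.mul hf), setLIntegral_congr Ioi_ae_eq_Ici]
    refine setLIntegral_congr_fun measurableSet_Ici fun s hs => ?_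
    simp only [oneilWeight, if_neg (not_lt.2 (mem_Ici.1 hs)), mul_assoc]

section Convolution

variable {n : ℕ} {k f : EuclideanSpace ℝ (Fin n) → ℝ≥0∞}

lemma measurable_convOp (hk : Measurable k) (hf : Measurable f) : Measurable (convOp k f) :=
  Measurable.lintegral_prod_right'
    (f := fun p : EuclideanSpace ℝ (Fin n) × EuclideanSpace ℝ (Fin n) => k (p.1 - p.2) * f p.2)
    ((hk.comp (measurable_fst.sub measurable_snd)).mul (hf.comp measurable_snd))

/-- O'Neil's inequality for the integral of a convolution over a set. -/
lemma ofReal_mul_setLIntegral_convOp_le (hk : Measurable k) (hf : Measurable f) {t : ℝ}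
    (ht : 0 < t) {E : Set (EuclideanSpace ℝ (Fin n))} (htE : ENNReal.ofReal t ≤ volume E) :
    ENNReal.ofReal t * ∫⁻ x in E, convOp k f x
      ≤ volume E * (opI (rearr k) t * opI (rearr f) t
        + ENNReal.ofReal t * ∫⁻ s in Ioi t, rearr k s * rearr f s) := by
  have hκ := (rearr_antitone k).measurable
  have hkm : Measurable fun p : EuclideanSpace ℝ (Fin n) × EuclideanSpace ℝ (Fin n) =>
      k (p.1 - p.2) := hk.comp (measurable_fst.sub measurable_snd)
  set e : EuclideanSpace ℝ (Fin n) → ℝ≥0∞ := fun y => ∫⁻ x in E, k (x - y) with he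
  have hem : Measurable e := Measurable.lintegral_prod_left' hkm
  -- By Tonelli the left side is ∫ e f; the layer-cake formula for the measure e dy then replaces f
  -- by its superlevel sets.
  have h1 : ∫⁻ x in E, convOp k f x = ∫⁻ l in Ioi (0 : ℝ), ∫⁻ y in {y | ENNReal.ofReal l < f y}, e y := by
    unfold convOp
    rw [lintegral_lintegral_swap (hkm.mul (hf.comp measurable_snd)).aemeasurable]
    have : ∀ y, ∫⁻ x in E, k (x - y) * f y = (e * f) y := fun y =>
      lintegral_mul_const _ (hk.comp (measurable_id.sub_const y))
    simp_rw [this]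
    rw [← lintegral_withDensity_eq_lintegral_mul _ hem hf, lintegral_eq_lintegral_meas_lt _ hf]
    refine lintegral_congr fun l => ?_
    rw [withDensity_apply _ (measurableSet_lt measurable_const hf)]
  -- Hardy–Littlewood is applied in x for fixed y (`ha`) and in y for fixed x (`hb`), as translates
  -- and reflections of k are equimeasurable with k. In the first bound, |E| ≥ t and the decrease of
  -- averages replace t (Ik*)(|E|) by |E| (Ik*)(t).
  have h2 : ∀ F, MeasurableSet F → ENNReal.ofReal t * ∫⁻ y in F, e y
      ≤ volume E * partialIntegral (oneilWeight (rearr k) t) (volume F) := by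
    intro F hF
    have ha : ∫⁻ y in F, e y ≤ volume F * partialIntegral (rearr k) (volume E) := by
      calc _ ≤ ∫⁻ _ in F, partialIntegral (rearr k) (volume E) := by
            refine lintegral_mono fun y => ?_
            refine setLIntegral_le_partialIntegral_rearr (hk.comp (measurable_id.sub_const y))
              (fun l => ?_) E
            have := measure_preimage_add_right volume (-y) {x | l < k x}
            simpa [sub_eq_add_neg] using this
        _ = _ := by rw [setLIntegral_const, mul_comm]
    have hb : ∫⁻ y in F, e y ≤ volume E * partialIntegral (rearr k) (volume F) := by
      calc _ = ∫⁻ x in E, ∫⁻ y in F, k (x - y) := by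
            rw [lintegral_lintegral_swap]
            exact (hkm.comp measurable_swap).aemeasurable
        _ ≤ ∫⁻ _ in E, partialIntegral (rearr k) (volume F) := by
            refine lintegral_mono fun x => ?_
            refine setLIntegral_le_partialIntegral_rearr (hk.comp (measurable_id.const_sub x))
              (fun l => ?_) F
            exact (Measure.measurePreserving_sub_left volume x).measure_preimage
              (measurableSet_lt measurable_const hk).nullMeasurableSet
        _ = _ := by rw [setLIntegral_const, mul_comm]
    refine le_trans ?_ (mul_le_mul_right (min_le_partialIntegral_oneilWeight hκ t (volume F)) _)
    rw [mul_min]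
    refine le_min ?_ ?_
    · calc _ ≤ ENNReal.ofReal t * (volume F * partialIntegral (rearr k) (volume E)) := by gcongr
        _ = volume F * (ENNReal.ofReal t * partialIntegral (rearr k) (volume E)) := by ring
        _ ≤ volume F * (volume E * opI (rearr k) t) := by
            rw [opI_eq]
            exact mul_le_mul_right (ofReal_mul_partialIntegral_le (rearr_antitone k) htE) _
        _ = _ := by ring
    · calc _ ≤ ENNReal.ofReal t * (volume E * partialIntegral (rearr k) (volume F)) := by gcongr
        _ = _ := by ring
  have hanti : Antitone fun l : ℝ => {y | ENNReal.ofReal l < f y} := fun a b hab y hy =>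
    (ENNReal.ofReal_le_ofReal hab).trans_lt hy
  have hm1 : Measurable fun l : ℝ => ∫⁻ y in {y | ENNReal.ofReal l < f y}, e y :=
    Antitone.measurable fun a b hab => lintegral_mono_set (hanti hab)
  have hm2 : Measurable fun l : ℝ =>
      partialIntegral (oneilWeight (rearr k) t) (volume {y | ENNReal.ofReal l < f y}) :=
    (measurable_partialIntegral _).comp
      (Antitone.measurable fun a b hab => measure_mono (hanti hab))
  rw [h1, ← lintegral_oneilWeight_mul hκ (rearr_antitone f).measurable ht,
    ← lintegral_partialIntegral_volume_lt (measurable_oneilWeight hκ t), ← lintegral_const_mul _ hm1,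
    ← lintegral_const_mul _ hm2]
  exact lintegral_mono fun l => h2 _ (measurableSet_lt measurable_const hf)

/-- O'Neil's inequality. -/
lemma rearr_convOp_le (hk : Measurable k) (hf : Measurable f) {t : ℝ} (ht : 0 < t) :
    rearr (convOp k f) t ≤ opI (rearr k) t * opI (rearr f) t / ENNReal.ofReal t
      + ∫⁻ s in Ioi t, rearr k s * rearr f s := by
  have hT0 : ENNReal.ofReal t ≠ 0 := by simpa using ht
  refine le_of_forall_lt_imp_le_of_dense fun a ha => ?_
  rw [lt_rearr_iff] at ha
  -- The superlevel set may have infinite measure; a subset E with t < |E| < ∞ allows |E| to be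
  -- cancelled at the end.
  obtain ⟨E, hE, hEsub, htE, hEfin⟩ := Measure.exists_subset_measure_lt_top
    (measurableSet_lt measurable_const (measurable_convOp hk hf)) ha
  have hE0 : volume E ≠ 0 := (pos_of_gt htE).ne'
  have h1 : a * volume E ≤ ∫⁻ x in E, convOp k f x := by
    rw [← setLIntegral_const]
    exact setLIntegral_mono' hE fun x hx => (hEsub hx).le
  have h2 := ofReal_mul_setLIntegral_convOp_le hk hf ht htE.le
  have h3 : volume E * (ENNReal.ofReal t * a) ≤ volume E * (opI (rearr k) t * opI (rearr f) t
        + ENNReal.ofReal t * ∫⁻ s in Ioi t, rearr k s * rearr f s) := by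
    refine le_trans (le_of_eq ?_) ((mul_le_mul_right h1 _).trans h2)
    ring
  have h4 := (ENNReal.mul_le_mul_iff_right hE0 hEfin.ne).1 h3
  have h5 : a ≤ (opI (rearr k) t * opI (rearr f) t
        + ENNReal.ofReal t * ∫⁻ s in Ioi t, rearr k s * rearr f s) / ENNReal.ofReal t := by
    rwa [ENNReal.le_div_iff_mul_le (Or.inl hT0) (Or.inl ENNReal.ofReal_ne_top), mul_comm]
  rwa [ENNReal.add_div, mul_comm (ENNReal.ofReal t) (∫⁻ s in Ioi t, _),
    ENNReal.mul_div_cancel_right hT0 ENNReal.ofReal_ne_top] at h5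

end Convolution

/-! ### Adjoint operators and pointwise bounds for the O'Neil terms -/

/-- The adjoint of `opA κ`. -/
def opAdjA (κ f : ℝ → ℝ≥0∞) (s : ℝ) : ℝ≥0∞ :=
  ∫⁻ t in Ioi s, f t / ENNReal.ofReal t * ∫⁻ y in Ioo s t, κ y

/-- The adjoint of `opB κ`. -/
def opAdjB (κ f : ℝ → ℝ≥0∞) (t : ℝ) : ℝ≥0∞ :=
  (∫⁻ s in Ioo 0 t, opI₂ κ s / ENNReal.ofReal s * f s) / ENNReal.ofReal t

lemma lintegral_triangle_swap (a : ℝ) {G : ℝ → ℝ → ℝ≥0∞} (hG : Measurable (Function.uncurry G)) :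
    ∫⁻ t in Ioi a, ∫⁻ s in Ioo a t, G s t = ∫⁻ s in Ioi a, ∫⁻ t in Ioi s, G s t := by
  have hS : MeasurableSet {p : ℝ × ℝ | p.1 < p.2} := measurableSet_lt measurable_fst measurable_snd
  have h1 : ∀ t, ∫⁻ s in Ioo a t, G s t = ∫⁻ s in Ioi a,
      {p : ℝ × ℝ | p.1 < p.2}.indicator (Function.uncurry G) (s, t) := by
    intro t
    rw [← Iio_inter_Ioi, ← Measure.restrict_restrict measurableSet_Iio,
      ← lintegral_indicator measurableSet_Iio]
    rfl
  simp_rw [h1]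
  rw [lintegral_lintegral_swap (f := fun t s =>
    {p : ℝ × ℝ | p.1 < p.2}.indicator (Function.uncurry G) (s, t))
    ((hG.indicator hS).comp measurable_swap).aemeasurable]
  refine setLIntegral_congr_fun measurableSet_Ioi fun s hs => ?_
  have h2 : Ioi s = Ioi s ∩ Ioi a := by
    rw [Ioi_inter_Ioi, max_eq_left (le_of_lt hs)]
  conv_rhs => rw [h2, ← Measure.restrict_restrict measurableSet_Ioi,
    ← lintegral_indicator measurableSet_Ioi]
  rfl

lemma measurable_lintegral_Ioo {κ : ℝ → ℝ≥0∞} (hκ : Measurable κ) :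
    Measurable fun p : ℝ × ℝ => ∫⁻ y in Ioo p.1 p.2, κ y := by
  have hS : MeasurableSet {q : (ℝ × ℝ) × ℝ | q.2 ∈ Ioo q.1.1 q.1.2} :=
    (measurableSet_lt (measurable_fst.comp measurable_fst) measurable_snd).inter
      (measurableSet_lt measurable_snd (measurable_snd.comp measurable_fst))
  have h := Measurable.lintegral_prod_right' (ν := (volume : Measure ℝ))
    ((hκ.comp measurable_snd).indicator hS)
  convert h using 2 with p
  rw [← lintegral_indicator measurableSet_Ioo]
  rfl

lemma lintegral_mul_opA {κ f g : ℝ → ℝ≥0∞} (hκ : Measurable κ) (hf : Measurable f)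
    (hg : Measurable g) :
    ∫⁻ t, f t * opA κ g t ∂volPos = ∫⁻ s, opAdjA κ f s * g s ∂volPos := by
  have hK := measurable_lintegral_Ioo hκ
  have hG : Measurable (Function.uncurry fun s t =>
      f t / ENNReal.ofReal t * (∫⁻ y in Ioo s t, κ y) * g s) := by
    refine Measurable.mul (Measurable.mul ?_ hK) (hg.comp measurable_fst)
    exact (hf.div ENNReal.measurable_ofReal).comp measurable_snd
  have h1 : ∀ t, f t * opA κ g t
      = ∫⁻ s in Ioo 0 t, f t / ENNReal.ofReal t * (∫⁻ y in Ioo s t, κ y) * g s := by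
    intro t
    have hm : Measurable fun s => g s * ∫⁻ y in Ioo s t, κ y :=
      hg.mul (hK.comp measurable_prodMk_right)
    rw [opA, div_eq_mul_inv, mul_comm (∫⁻ s in Ioo 0 t, _), ← mul_assoc, ← div_eq_mul_inv,
      ← lintegral_const_mul _ hm]
    exact lintegral_congr fun s => by ring
  have h2 : ∀ s, opAdjA κ f s * g s
      = ∫⁻ t in Ioi s, f t / ENNReal.ofReal t * (∫⁻ y in Ioo s t, κ y) * g s := by
    intro s
    rw [opAdjA, lintegral_mul_const]
    exact (hf.div ENNReal.measurable_ofReal).mul (hK.comp measurable_prodMk_left)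
  simp_rw [h1, h2]
  exact lintegral_triangle_swap 0 hG

lemma lintegral_mul_opB {κ f g : ℝ → ℝ≥0∞} (hf : Measurable f) (hg : Measurable g) :
    ∫⁻ t, f t * opB κ g t ∂volPos = ∫⁻ s, opAdjB κ f s * g s ∂volPos := by
  have hw : Measurable fun s => opI₂ κ s / ENNReal.ofReal s * f s :=
    ((measurable_opI₂ κ).div ENNReal.measurable_ofReal).mul hf
  have hgm : Measurable fun t => g t / ENNReal.ofReal t := hg.div ENNReal.measurable_ofReal
  have h1 : ∀ s, f s * opB κ g s
      = ∫⁻ t in Ioi s, opI₂ κ s / ENNReal.ofReal s * f s * (g t / ENNReal.ofReal t) := by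
    intro s
    rw [opB, lintegral_const_mul _ hgm]
    ring
  have h2 : ∀ t, opAdjB κ f t * g t
      = ∫⁻ s in Ioo 0 t, opI₂ κ s / ENNReal.ofReal s * f s * (g t / ENNReal.ofReal t) := by
    intro t
    rw [opAdjB, lintegral_mul_const _ hw, div_eq_mul_inv, div_eq_mul_inv]
    ring
  simp_rw [h1, h2]
  exact (lintegral_triangle_swap 0
    (G := fun s t => opI₂ κ s / ENNReal.ofReal s * f s * (g t / ENNReal.ofReal t))
    ((hw.comp measurable_fst).mul (hgm.comp measurable_snd))).symm

lemma antitone_opAdjA (κ f : ℝ → ℝ≥0∞) : Antitone (opAdjA κ f) := fun _ _ hab =>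
  (lintegral_mono_set (Ioi_subset_Ioi hab)).trans <| lintegral_mono fun _ =>
    mul_le_mul_right (lintegral_mono_set (Ioo_subset_Ioo_left hab)) _

lemma measurable_opAdjB (κ f : ℝ → ℝ≥0∞) : Measurable (opAdjB κ f) :=
  (measurable_opI _).div ENNReal.measurable_ofReal

lemma opI_le_two_mul_opI_half {κ : ℝ → ℝ≥0∞} (hκ : Antitone κ) {s : ℝ} (hs : 0 < s) :
    opI κ s ≤ 2 * opI κ (s / 2) := by
  have h := ofReal_mul_partialIntegral_le hκ (t := s / 2) (m := ENNReal.ofReal s)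
    (ENNReal.ofReal_le_ofReal (by linarith))
  have h2 : ENNReal.ofReal s = ENNReal.ofReal (s / 2) * 2 := by
    rw [← ENNReal.ofReal_ofNat, ← ENNReal.ofReal_mul (by linarith)]; congr 1; ring
  rw [h2, mul_assoc, ← h2] at h
  rw [opI_eq, opI_eq]
  refine (ENNReal.mul_le_mul_iff_right ?_ ENNReal.ofReal_ne_top).1 h
  simpa using hs

/-- Since Iκ is nondecreasing, integrating it over (s/2, s) gives (I₂κ)(s) ≥ (s/2)(Iκ)(s/2); the
decrease of averages of κ gives (Iκ)(s/2) ≥ (Iκ)(s)/2. -/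
lemma opI_le_four_mul_opI₂_div {κ : ℝ → ℝ≥0∞} (hκ : Antitone κ) {s : ℝ} (hs : 0 < s) :
    opI κ s ≤ 4 * (opI₂ κ s / ENNReal.ofReal s) := by
  have h1 : ENNReal.ofReal (s / 2) * opI κ (s / 2) ≤ opI₂ κ s := by
    calc _ = ∫⁻ _ in Ioo (s / 2) s, opI κ (s / 2) := by
          rw [setLIntegral_const, Real.volume_Ioo, mul_comm]; congr 2; ring
      _ ≤ ∫⁻ u in Ioo (s / 2) s, opI κ u :=
          setLIntegral_mono' measurableSet_Ioo fun u hu => monotone_opI κ hu.1.le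
      _ ≤ _ := lintegral_mono_set (Ioo_subset_Ioo_left (by linarith))
  have h2 : ENNReal.ofReal s = 2 * ENNReal.ofReal (s / 2) := by
    rw [← ENNReal.ofReal_ofNat, ← ENNReal.ofReal_mul (by norm_num)]; congr 1; ring
  have hs0 : ENNReal.ofReal s ≠ 0 := by simpa using hs
  rw [← mul_div_assoc, ENNReal.le_div_iff_mul_le (Or.inl hs0) (Or.inl ENNReal.ofReal_ne_top)]
  calc _ ≤ 2 * opI κ (s / 2) * (2 * ENNReal.ofReal (s / 2)) := by
        rw [h2]; gcongr; exact opI_le_two_mul_opI_half hκ hs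
    _ = 4 * (ENNReal.ofReal (s / 2) * opI κ (s / 2)) := by ring
    _ ≤ _ := by gcongr

/-- Under the integral against f(s), split (Iκ)(t) at s. The part over (s, t) produces `opA`, and
the part (Iκ)(s) is traded for 4 (I₂κ)(s)/s, the kernel of the adjoint of `opB`. -/
lemma opI_mul_opI_div_le {κ f : ℝ → ℝ≥0∞} (hκ : Antitone κ) (hf : Measurable f) (t : ℝ) :
    opI κ t * opI f t / ENNReal.ofReal t ≤ opA κ f t + 4 * opAdjB κ f t := by
  have hw : Measurable fun s => opI₂ κ s / ENNReal.ofReal s * f s :=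
    ((measurable_opI₂ κ).div ENNReal.measurable_ofReal).mul hf
  have hw4 : Measurable fun s => 4 * (opI₂ κ s / ENNReal.ofReal s * f s) := hw.const_mul 4
  rw [opA, opAdjB, ← mul_div_assoc, ← ENNReal.add_div, ← lintegral_const_mul _ hw,
    ← lintegral_add_right _ hw4]
  refine ENNReal.div_le_div_right ?_ _
  conv_lhs => rw [opI.eq_1 f]
  rw [← lintegral_const_mul _ hf]
  refine setLIntegral_mono' measurableSet_Ioo fun s hs => ?_
  have h1 : opI κ t ≤ (∫⁻ y in Ioo s t, κ y) + opI κ s := by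
    rw [opI, ← Ioc_union_Ioo_eq_Ioo hs.1.le hs.2, add_comm]
    refine (lintegral_union_le _ _ _).trans (le_of_eq ?_)
    rw [opI, setLIntegral_congr (Ioo_ae_eq_Ioc (a := 0) (b := s))]
  calc opI κ t * f s
      ≤ ((∫⁻ y in Ioo s t, κ y) + 4 * (opI₂ κ s / ENNReal.ofReal s)) * f s := by
        gcongr
        exact h1.trans (add_le_add_right (opI_le_four_mul_opI₂_div hκ hs.1) _)
    _ = _ := by ring

/-- By Tonelli the adjoint is the integral over y > t of κ(y) ∫_y^∞ f(s/2) ds/s. On (y, 2y) one has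
f(s/2) ≥ f(y) and 1/s ≥ 1/(2y), so the inner integral is at least f(y)/2. The dilation is what makes
a lower bound by f(y) possible for s > y. -/
lemma lintegral_Ioi_mul_le_opAdjA {κ f : ℝ → ℝ≥0∞} (hκ : Measurable κ) (hf : Antitone f) {t : ℝ}
    (ht : 0 < t) :
    ∫⁻ s in Ioi t, κ s * f s ≤ 2 * opAdjA κ (fun s => f (s / 2)) t := by
  have hF : Measurable fun s => f (s / 2) / ENNReal.ofReal s :=
    (hf.measurable.comp (measurable_id.div_const 2)).div ENNReal.measurable_ofReal
  have hG : Measurable (Function.uncurry fun y s => f (s / 2) / ENNReal.ofReal s * κ y) :=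
    (hF.comp measurable_snd).mul (hκ.comp measurable_fst)
  have h1 : opAdjA κ (fun s => f (s / 2)) t
      = ∫⁻ y in Ioi t, ∫⁻ s in Ioi y, f (s / 2) / ENNReal.ofReal s * κ y := by
    rw [← lintegral_triangle_swap t hG, opAdjA]
    exact lintegral_congr fun s => (lintegral_const_mul _ hκ).symm
  have hm : Measurable fun y => ∫⁻ s in Ioi y, f (s / 2) / ENNReal.ofReal s * κ y := by
    have : ∀ y, ∫⁻ s in Ioi y, f (s / 2) / ENNReal.ofReal s * κ y
        = (∫⁻ s in Ioi y, f (s / 2) / ENNReal.ofReal s) * κ y := fun y =>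
      lintegral_mul_const _ hF
    simp_rw [this]
    refine Measurable.mul (Antitone.measurable fun a b hab => ?_) hκ
    exact lintegral_mono_set (Ioi_subset_Ioi hab)
  rw [h1, ← lintegral_const_mul _ hm]
  refine setLIntegral_mono' measurableSet_Ioi fun y hy => ?_
  have hy0 : 0 < y := ht.trans hy
  have hy' : ENNReal.ofReal y ≠ 0 := by simpa using hy0
  rw [lintegral_mul_const _ hF]
  have h2 : f y ≤ 2 * ∫⁻ s in Ioi y, f (s / 2) / ENNReal.ofReal s := by
    calc f y = 2 * (f y / ENNReal.ofReal (2 * y) * volume (Ioo y (2 * y))) := by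
          rw [Real.volume_Ioo, two_mul y, add_sub_cancel_right, ← two_mul,
            ENNReal.ofReal_mul (by norm_num), ENNReal.ofReal_ofNat, div_eq_mul_inv,
            ENNReal.mul_inv (Or.inl (by simp)) (Or.inl (by simp))]
          calc f y = f y * (2 * 2⁻¹) * ((ENNReal.ofReal y)⁻¹ * ENNReal.ofReal y) := by
                rw [ENNReal.mul_inv_cancel (by simp) (by simp),
                  ENNReal.inv_mul_cancel hy' ENNReal.ofReal_ne_top, mul_one, mul_one]
            _ = _ := by ring
      _ = 2 * ∫⁻ _ in Ioo y (2 * y), f y / ENNReal.ofReal (2 * y) := by rw [setLIntegral_const]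
      _ ≤ 2 * ∫⁻ s in Ioo y (2 * y), f (s / 2) / ENNReal.ofReal s := by
          gcongr 2 * ?_
          refine setLIntegral_mono' measurableSet_Ioo fun s hs => ?_
          exact ENNReal.div_le_div (hf (by linarith [hs.2])) (ENNReal.ofReal_le_ofReal hs.2.le)
      _ ≤ _ := by
          gcongr 2 * ?_
          exact lintegral_mono_set Ioo_subset_Ioi_self
  calc κ y * f y ≤ κ y * (2 * ∫⁻ s in Ioi y, f (s / 2) / ENNReal.ofReal s) := by gcongr
    _ = _ := by ring

/-! ### Gauge norms: scaling, quasi-triangle inequality, duality -/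

section Gauge

variable {α : Type*} [MeasurableSpace α] {μ : Measure α}

lemma gaugeNorm_congr {Φ : ℝ≥0∞ → ℝ≥0∞} {f g : α → ℝ≥0∞} (h : f =ᵐ[μ] g) :
    gaugeNorm Φ μ f = gaugeNorm Φ μ g := by
  unfold gaugeNorm
  congr 1
  ext l
  have : ∫⁻ x, Φ (f x / l) ∂μ = ∫⁻ x, Φ (g x / l) ∂μ :=
    lintegral_congr_ae (h.mono fun x hx => by simp only [hx])
  simp only [mem_ofPred_eq, this]

lemma gaugeNorm_le {Φ : ℝ≥0∞ → ℝ≥0∞} {f : α → ℝ≥0∞} {l : ℝ≥0∞} (h0 : l ≠ 0) (ht : l ≠ ∞)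
    (h : ∫⁻ x, Φ (f x / l) ∂μ ≤ 1) : gaugeNorm Φ μ f ≤ l :=
  sInf_le ⟨pos_iff_ne_zero.2 h0, lt_top_iff_ne_top.2 ht, h⟩

lemma gaugeNorm_le_mul {Φ Φ' : ℝ≥0∞ → ℝ≥0∞} {β : Type*} [MeasurableSpace β] {ν : Measure β}
    {f : α → ℝ≥0∞} {g : β → ℝ≥0∞} {C : ℝ≥0∞} (hC : C ≠ 0) (hC' : C ≠ ∞)
    (h : ∀ l, l ≠ 0 → l ≠ ∞ → ∫⁻ x, Φ' (g x / l) ∂ν ≤ 1 → gaugeNorm Φ μ f ≤ C * l) :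
    gaugeNorm Φ μ f ≤ C * gaugeNorm Φ' ν g := by
  rw [mul_comm, ← ENNReal.div_le_iff hC hC']
  refine le_sInf fun l hl => ?_
  rw [ENNReal.div_le_iff hC hC', mul_comm]
  exact h l hl.1.ne' hl.2.1.ne hl.2.2

lemma gaugeNorm_mono {w : ℝ → ℝ≥0∞} {f g : α → ℝ≥0∞} (h : ∀ᵐ x ∂μ, f x ≤ g x) :
    gaugeNorm (partialIntegral w) μ f ≤ gaugeNorm (partialIntegral w) μ g := by
  refine sInf_le_sInf fun l hl => ⟨hl.1, hl.2.1, le_trans (lintegral_mono_ae ?_) hl.2.2⟩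
  exact h.mono fun x hx => partialIntegral_mono_right w (ENNReal.div_le_div_right hx l)

/-- The strict inequality avoids asking whether the infimum is attained: some smaller l is
admissible, and the modular decreases in l. -/
lemma lintegral_partialIntegral_div_le_one {w : ℝ → ℝ≥0∞} {f : α → ℝ≥0∞} {l : ℝ≥0∞}
    (h : gaugeNorm (partialIntegral w) μ f < l) :
    ∫⁻ x, partialIntegral w (f x / l) ∂μ ≤ 1 := by
  obtain ⟨m, hm, hml⟩ := sInf_lt_iff.1 h
  refine (lintegral_mono fun x => ?_).trans hm.2.2
  exact partialIntegral_mono_right w (ENNReal.div_le_div_left hml.le _)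

lemma two_mul_partialIntegral_div_le {w : ℝ → ℝ≥0∞} (hw : Monotone w) (x : ℝ≥0∞) :
    2 * partialIntegral w (x / 2) ≤ partialIntegral w x := by
  simpa using mul_partialIntegral_div_le hw x (c := 2) (by norm_num)

lemma div_two_mul (x l : ℝ≥0∞) : x / (2 * l) = x / l / 2 := by
  rw [div_eq_mul_inv, div_eq_mul_inv, div_eq_mul_inv,
    ENNReal.mul_inv (Or.inl (by simp)) (Or.inl (by simp)), mul_comm 2⁻¹, mul_assoc]

/-- Quasi-triangle inequality for the gauge norm. -/
lemma gaugeNorm_add_le {w : ℝ → ℝ≥0∞} (hw : Monotone w) {f g : α → ℝ≥0∞} (hg : Measurable g) :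
    gaugeNorm (partialIntegral w) μ (fun x => f x + g x)
      ≤ 4 * (gaugeNorm (partialIntegral w) μ f + gaugeNorm (partialIntegral w) μ g) := by
  set a := gaugeNorm (partialIntegral w) μ f + gaugeNorm (partialIntegral w) μ g with ha
  have h4 : (4 : ℝ≥0∞) ≠ 0 := by simp
  rw [mul_comm, ← ENNReal.div_le_iff h4 (by simp)]
  refine le_of_forall_gt_imp_ge_of_dense fun l hl => ?_
  rw [ENNReal.div_le_iff h4 (by simp), mul_comm]
  rcases eq_or_ne l ∞ with rfl | hlt
  · simp
  have hl0 : l ≠ 0 := (pos_of_gt hl).ne'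
  have hf1 := lintegral_partialIntegral_div_le_one (le_self_add.trans_lt hl)
  have hg1 := lintegral_partialIntegral_div_le_one (le_add_self.trans_lt hl)
  refine gaugeNorm_le (mul_ne_zero h4 hl0) (ENNReal.mul_ne_top (by simp) hlt) ?_
  -- Of the factor 4, one 2 pays for f + g ≤ 2 max(f, g); the other, by convexity, halves the sum of
  -- the two modulars.
  have hpt : ∀ x, 2 * partialIntegral w ((f x + g x) / (4 * l))
      ≤ partialIntegral w (f x / l) + partialIntegral w (g x / l) := by
    intro x
    have h1 : (f x + g x) / (4 * l) ≤ max (f x / l) (g x / l) / 2 := by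
      have : (4 : ℝ≥0∞) * l = 2 * (2 * l) := by ring
      rw [this, div_two_mul, div_two_mul]
      refine ENNReal.div_le_div_right ?_ 2
      rw [ENNReal.div_le_iff (by simp) (by simp), ENNReal.add_div, mul_two]
      exact add_le_add (le_max_left _ _) (le_max_right _ _)
    calc _ ≤ 2 * partialIntegral w (max (f x / l) (g x / l) / 2) := by
          gcongr; exact partialIntegral_mono_right w h1
      _ ≤ partialIntegral w (max (f x / l) (g x / l)) := two_mul_partialIntegral_div_le hw _
      _ = max (partialIntegral w (f x / l)) (partialIntegral w (g x / l)) :=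
          (partialIntegral_mono_right w).map_max
      _ ≤ _ := max_le le_self_add le_add_self
  have h2 : 2 * ∫⁻ x, partialIntegral w ((f x + g x) / (4 * l)) ∂μ ≤ 2 * 1 := by
    rw [← lintegral_const_mul' _ _ (by simp)]
    calc _ ≤ ∫⁻ x, (partialIntegral w (f x / l) + partialIntegral w (g x / l)) ∂μ :=
          lintegral_mono hpt
      _ = _ := lintegral_add_right _ ((measurable_partialIntegral w).comp (hg.div_const l))
      _ ≤ 1 + 1 := add_le_add hf1 hg1
      _ = 2 * 1 := by rw [mul_one, one_add_one_eq_two]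
  exact (ENNReal.mul_le_mul_iff_right (by simp) (by simp)).1 h2

lemma gaugeNorm_const_mul_le {Φ : ℝ≥0∞ → ℝ≥0∞} {c : ℝ≥0∞} (hc : c ≠ 0) (hc' : c ≠ ∞)
    (f : α → ℝ≥0∞) : gaugeNorm Φ μ (fun x => c * f x) ≤ c * gaugeNorm Φ μ f := by
  refine gaugeNorm_le_mul hc hc' fun l h0 ht h => ?_
  refine gaugeNorm_le (mul_ne_zero hc h0) (ENNReal.mul_ne_top hc' ht) ?_
  simpa only [ENNReal.mul_div_mul_left _ _ hc hc'] using h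

/-- Dilation by two is bounded on the gauge spaces. -/
lemma gaugeNorm_comp_half_le {w : ℝ → ℝ≥0∞} (hw : Monotone w) (f : ℝ → ℝ≥0∞) :
    gaugeNorm (partialIntegral w) volPos (fun s => f (s / 2))
      ≤ 2 * gaugeNorm (partialIntegral w) volPos f := by
  refine gaugeNorm_le_mul (by simp) (by simp) fun l h0 ht h => ?_
  refine gaugeNorm_le (mul_ne_zero (by simp) h0) (ENNReal.mul_ne_top (by simp) ht) ?_
  unfold volPos at h ⊢
  rw [setLIntegral_mul_left (c := 2) (by norm_num)]
  have hpre : (fun y : ℝ => 2 * y) ⁻¹' Ioi 0 = Ioi 0 := by ext; simp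
  -- The Jacobian 2 is absorbed by convexity, 2 W(x/2) ≤ W(x).
  rw [hpre, ENNReal.ofReal_ofNat, ← lintegral_const_mul' _ _ (by simp)]
  refine (lintegral_mono fun s => ?_).trans h
  rw [mul_div_cancel_left₀ s (two_ne_zero), div_two_mul]
  exact two_mul_partialIntegral_div_le hw _

/-- A bound for `A` between complementary gauge norms passes to the adjoint of `A`. -/
lemma gaugeNorm_adjoint_le (N₁ N₂ : NFunction) [SigmaFinite μ] {f : α → ℝ≥0∞} (hf : Measurable f)
    {A : (α → ℝ≥0∞) → α → ℝ≥0∞} {h : α → ℝ≥0∞} (hh : Measurable h)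
    (hadj : ∀ g, Measurable g → ∫⁻ x, f x * A g x ∂μ = ∫⁻ x, h x * g x ∂μ) {C : ℝ≥0} (hC : 0 < C)
    (hA : ∀ g, AEMeasurable g μ → gaugeNorm N₂.compl μ (A g) ≤ C * gaugeNorm N₁.compl μ g) :
    gaugeNorm N₁.eval μ h ≤ ↑(4 * C) * gaugeNorm N₂.eval μ f := by
  have hC0 : (C : ℝ≥0∞) ≠ 0 := by simpa using hC.ne'
  have hC4 : ((4 * C : ℝ≥0) : ℝ≥0∞) ≠ 0 := by simpa using hC.ne'
  refine gaugeNorm_le_mul hC4 ENNReal.coe_ne_top fun l h0 ht hl => ?_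
  -- L = l · 2C · 2: the last 2 is the Hölder constant, and 2C replaces C so that the gauge norm of
  -- A g lies strictly below it.
  set L : ℝ≥0∞ := ↑(4 * C) * l with hL
  have hL0 : L ≠ 0 := mul_ne_zero hC4 h0
  have hLt : L ≠ ∞ := ENNReal.mul_ne_top ENNReal.coe_ne_top ht
  refine gaugeNorm_le hL0 hLt ?_
  refine N₁.lintegral_eval_le_one (hh.div_const L) fun g hg hg1 => ?_
  have hgn : gaugeNorm N₁.compl μ g ≤ 1 := gaugeNorm_le one_ne_zero ENNReal.one_ne_top (by simpa)
  have hAg : gaugeNorm N₂.compl μ (A g) < 2 * C := by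
    calc _ ≤ C * gaugeNorm N₁.compl μ g := hA g hg.aemeasurable
      _ ≤ C * 1 := by gcongr
      _ < _ := by
        rw [mul_one, two_mul]
        exact ENNReal.lt_add_right ENNReal.coe_ne_top hC0
  rw [N₂.compl_eq] at hAg
  have hmod := lintegral_partialIntegral_div_le_one hAg
  rw [← N₂.compl_eq] at hmod
  have hold := N₂.lintegral_mul_le_two (hf.div_const l) hl hmod
  have h1 : ∫⁻ x, f x * A g x ∂μ = l * (2 * C) * ∫⁻ x, f x / l * (A g x / (2 * C)) ∂μ := by
    have h2C : (2 * C : ℝ≥0∞) ≠ 0 := mul_ne_zero (by simp) hC0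
    have h2C' : (2 * C : ℝ≥0∞) ≠ ∞ := ENNReal.mul_ne_top (by simp) ENNReal.coe_ne_top
    rw [← lintegral_const_mul' _ _ (ENNReal.mul_ne_top ht h2C')]
    refine lintegral_congr fun x => ?_
    calc f x * A g x = l * (f x / l) * (2 * C * (A g x / (2 * C))) := by
          rw [ENNReal.mul_div_cancel h0 ht, ENNReal.mul_div_cancel h2C h2C']
      _ = _ := by ring
  calc ∫⁻ x, h x / L * g x ∂μ = (∫⁻ x, h x * g x ∂μ) / L := by
        rw [div_eq_mul_inv, ← lintegral_mul_const' _ _ (ENNReal.inv_ne_top.2 hL0)]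
        exact lintegral_congr fun x => by rw [div_eq_mul_inv]; ring
    _ ≤ 1 := by
        rw [ENNReal.div_le_iff hL0 hLt, one_mul, ← hadj g hg, h1]
        calc _ ≤ l * (2 * C) * 2 := by gcongr
          _ = L := by rw [hL]; push_cast; ring

end Gauge

/-! ### Assembly of the estimates -/

section Main

variable {n : ℕ}

/-- Equality holds at every x, because y ↦ x - y preserves null sets. Hence k and f may be replaced
by measurable representatives. -/
lemma convOp_congr {k k' f f' : EuclideanSpace ℝ (Fin n) → ℝ≥0∞} (hk : k =ᵐ[volume] k')
    (hf : f =ᵐ[volume] f') : convOp k f = convOp k' f' := by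
  ext x
  refine lintegral_congr_ae ?_
  have h := (Measure.measurePreserving_sub_left volume x).quasiMeasurePreserving.ae hk
  filter_upwards [h, hf] with y h1 h2
  rw [h1, h2]

/-- The boundedness theorem on rearrangements, for measurable representatives. -/
lemma gaugeNorm_rearr_convOp_le (Φ₁ Φ₂ : NFunction) {k f : EuclideanSpace ℝ (Fin n) → ℝ≥0∞}
    (hk : Measurable k) (hf : Measurable f) {C₁ C₂ C₃ : ℝ≥0} (h₂ : 0 < C₂) (h₃ : 0 < C₃)
    (hA : ∀ f : ℝ → ℝ≥0∞, AEMeasurable f volPos →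
      gaugeNorm Φ₁.eval volPos (opA (rearr k) f) ≤ C₁ * gaugeNorm Φ₂.eval volPos f)
    (hA' : ∀ g : ℝ → ℝ≥0∞, AEMeasurable g volPos →
      gaugeNorm Φ₂.compl volPos (opA (rearr k) g) ≤ C₂ * gaugeNorm Φ₁.compl volPos g)
    (hB : ∀ g : ℝ → ℝ≥0∞, AEMeasurable g volPos →
      gaugeNorm Φ₂.compl volPos (opB (rearr k) g) ≤ C₃ * gaugeNorm Φ₁.compl volPos g) :
    gaugeNorm Φ₁.eval volPos (rearr (convOp k f))
      ≤ ↑(4 * (C₁ + 4 * (16 * C₂ + 16 * C₃)) : ℝ≥0) * gaugeNorm Φ₂.eval volPos (rearr f) := by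
  have : SigmaFinite volPos := by unfold volPos; infer_instance
  have hκa := rearr_antitone k
  have hκ := hκa.measurable
  have hfa := rearr_antitone f
  have hfm := hfa.measurable
  set F : ℝ → ℝ≥0∞ := fun s => rearr f (s / 2) with hF
  have hFm : Measurable F := hfm.comp (measurable_id.div_const 2)
  set r := gaugeNorm Φ₂.eval volPos (rearr f) with hr
  have hFr : gaugeNorm Φ₂.eval volPos F ≤ 2 * r := by
    rw [hr, Φ₂.eval_eq]; exact gaugeNorm_comp_half_le Φ₂.monotone_weight _
  have mA : Measurable (opAdjA (rearr k) F) := (antitone_opAdjA _ _).measurable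
  have mB : Measurable (opAdjB (rearr k) (rearr f)) := measurable_opAdjB _ _
  have bA : gaugeNorm Φ₁.eval volPos (opAdjA (rearr k) F) ≤ ↑(4 * C₂) * (2 * r) :=
    (gaugeNorm_adjoint_le Φ₁ Φ₂ hFm mA (fun g hg => lintegral_mul_opA hκ hFm hg) h₂ hA').trans
      (by gcongr)
  have bB : gaugeNorm Φ₁.eval volPos (opAdjB (rearr k) (rearr f)) ≤ ↑(4 * C₃) * r :=
    gaugeNorm_adjoint_le Φ₁ Φ₂ hfm mB (fun g hg => lintegral_mul_opB hfm hg) h₃ hB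
  have bA0 : gaugeNorm Φ₁.eval volPos (opA (rearr k) (rearr f)) ≤ C₁ * r := hA _ hfm.aemeasurable
  have hpt : ∀ᵐ t ∂volPos, rearr (convOp k f) t
      ≤ opA (rearr k) (rearr f) t
        + (2 * opAdjA (rearr k) F t + 4 * opAdjB (rearr k) (rearr f) t) := by
    refine (ae_restrict_iff' measurableSet_Ioi).2 (Filter.Eventually.of_forall fun t ht => ?_)
    refine (rearr_convOp_le hk hf ht).trans ?_
    rw [add_comm (2 * _) (4 * _), ← add_assoc]
    exact add_le_add (opI_mul_opI_div_le hκa hfm t) (lintegral_Ioi_mul_le_opAdjA hκ hfa ht)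
  have cA := (gaugeNorm_const_mul_le (Φ := Φ₁.eval) (μ := volPos) (c := 2) (by simp) (by simp)
    (opAdjA (rearr k) F)).trans (mul_le_mul_right bA 2)
  have cB := (gaugeNorm_const_mul_le (Φ := Φ₁.eval) (μ := volPos) (c := 4) (by simp) (by simp)
    (opAdjB (rearr k) (rearr f))).trans (mul_le_mul_right bB 4)
  rw [Φ₁.eval_eq] at cA cB bA0 ⊢
  have mB4 : Measurable fun t => 4 * opAdjB (rearr k) (rearr f) t := mB.const_mul 4
  have mA2 : Measurable fun t => 2 * opAdjA (rearr k) F t := mA.const_mul 2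
  calc _ ≤ _ := gaugeNorm_mono hpt
    _ ≤ 4 * (gaugeNorm (partialIntegral Φ₁.weight) volPos (opA (rearr k) (rearr f)) + _) :=
        gaugeNorm_add_le Φ₁.monotone_weight (mA2.add mB4)
    -- The quasi-triangle inequality is used twice, once for each outer 4. Then 16 C₂ collects the
    -- coefficient 2, the duality constant 4 C₂ and the dilation factor 2, while 16 C₃ collects the
    -- coefficient 4 and 4 C₃.
    _ ≤ 4 * (C₁ * r + 4 * (2 * (↑(4 * C₂) * (2 * r)) + 4 * (↑(4 * C₃) * r))) := by
        gcongr
        refine (gaugeNorm_add_le Φ₁.monotone_weight mB4).trans ?_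
        gcongr
    _ = _ := by push_cast; ring

end Main

end OrliczGauge

end

theorem theorem1 (n : ℕ) (hn : 1 ≤ n) (k : EuclideanSpace ℝ (Fin n) → ℝ≥0∞)
    (hk : AEMeasurable k volume) (Φ₁ Φ₂ : NFunction) (hΦ₂ : Φ₂.DoublingAtInfinity)
    (h_i : ∃ C : ℝ≥0, 0 < C ∧ ∀ f : ℝ → ℝ≥0∞, AEMeasurable f volPos →
      gaugeNorm Φ₁.eval volPos (opA (rearr k) f) ≤ C * gaugeNorm Φ₂.eval volPos f)
    (h_ii : ∃ C : ℝ≥0, 0 < C ∧ ∀ g : ℝ → ℝ≥0∞, AEMeasurable g volPos →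
      gaugeNorm Φ₂.compl volPos (opA (rearr k) g) ≤ C * gaugeNorm Φ₁.compl volPos g)
    (h_iii : ∃ C : ℝ≥0, 0 < C ∧ ∀ g : ℝ → ℝ≥0∞, AEMeasurable g volPos →
      gaugeNorm Φ₂.compl volPos (opB (rearr k) g) ≤ C * gaugeNorm Φ₁.compl volPos g)
    (h_iv : ∃ C : ℝ≥0, 0 < C ∧ ∀ g : ℝ → ℝ≥0∞, AEMeasurable g volPos →
      gaugeNorm Φ₂.compl volPos (opD (rearr k) g) ≤ C * gaugeNorm Φ₁.compl volPos g) :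
    ∃ C : ℝ≥0, 0 < C ∧ ∀ f : EuclideanSpace ℝ (Fin n) → ℝ≥0∞, AEMeasurable f volume →
      gaugeNorm Φ₁.eval volume (convOp k f) ≤ C * gaugeNorm Φ₂.eval volume f ∧
      gaugeNorm Φ₁.eval volPos (rearr (convOp k f)) ≤ C * gaugeNorm Φ₂.eval volPos (rearr f) := by
  obtain ⟨C₁, hC₁, hA⟩ := h_i
  obtain ⟨C₂, hC₂, hA'⟩ := h_ii
  obtain ⟨C₃, hC₃, hB⟩ := h_iii
  refine ⟨4 * (C₁ + 4 * (16 * C₂ + 16 * C₃)), by positivity, fun f hf => ?_⟩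
  have hmk := hk.measurable_mk
  have hmf := hf.measurable_mk
  rw [rearr_congr hk.ae_eq_mk] at hA hA' hB
  have h := gaugeNorm_rearr_convOp_le Φ₁ Φ₂ hmk hmf hC₂ hC₃ hA hA' hB
  rw [convOp_congr hk.ae_eq_mk hf.ae_eq_mk, rearr_congr hf.ae_eq_mk,
    gaugeNorm_congr hf.ae_eq_mk]
  refine ⟨?_, h⟩
  -- By equimeasurability, the bound on rearrangements is itself the bound over ℝⁿ.
  rw [Φ₁.eval_eq, Φ₂.eval_eq,
    gaugeNorm_rearr Φ₁.monotone_weight.measurable (measurable_convOp hmk hmf),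
    gaugeNorm_rearr Φ₂.monotone_weight.measurable hmf] at h
  rwa [Φ₁.eval_eq, Φ₂.eval_eq]
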